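/- Let $\mathcal Y$ and $\Theta$ be measurable spaces (for instance $\Theta\subseteq\mathbb R^p$), let $\{\mu_\theta:\theta\in\Theta\}$ be a statistical model of probability measures on $\mathcal Y$ depending measurably on $\theta$, let $\pi$ be a prior probability measure on $\Theta$, and let $y_1,y_2,\dots$ be i.i.d. from a probability measure $\mu^*$ on $\mathcal Y$. Let $\mathfrak F$ be a $b$-uniformly bounded class of measurable functions $f:\mathcal Y\to\mathbb R$, i.e. $\sup_{y}|f(y)|\le b$ for all $f\in\mathfrak F$ (with the suprema over $\mathfrak F$ below measurable). For probability measures $\mu_1,\mu_2$ on $\mathcal Y$ put $\mathcal D_{\mathfrak F}(\mu_1,\mu_2)=\sup_{f\in\mathfrak F}|\int f\,d\mu_1-\int f\,d\mu_2|$, for $x_{1:n}\in\mathcal Y^n$ put $\hat\mu_{x_{1:n}}=n^{-1}\sum_{i=1}^n\delta_{x_i}$, and let $$\mathfrak R_n(\mathfrak F)=\sup_{\mu}\ \mathbb E\Big[\sup_{f\in\mathfrak F}\Big|\frac1n\sum_{i=1}^n\epsilon_i f(x_i)\Big|\Big],$$ where the outer supremum is over all probability measures $\mu$ on $\mathcal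 Y$, $x_1,\dots,x_n$ are i.i.d. from $\mu$, and $\epsilon_1,\dots,\epsilon_n$ are independent i.i.d. Rademacher signs. Let $c_{\mathfrak F}=4\limsup_n\mathfrak R_n(\mathfrak F)$ and fix $\varepsilon>0$. Let $$p_n(\theta)=\mu_\theta^n\{z_{1:n}:\mathcal D_{\mathfrak F}(\hat\mu_{z_{1:n}},\hat\mu_{y_{1:n}})\le\varepsilon\},\qquad p_n=\int_\Theta p_n(\theta)\,\pi(d\theta),\qquad \pi_n^{(\varepsilon)}(A)=\frac1{p_n}\int_A p_n(\theta)\,\pi(d\theta)$$ be the acceptance probability of $\theta$, the acceptance probability of rejection ABC, and the ABC posterior. Then, almost surely with respect to $(y_i)_{i\ge1}$, as $n\to\infty$, $$\pi\{\theta:\mathcal D_{\mathfrak F}(\mu_\theta,\mu^*)<\varepsilon-c_{\mathfrak F}\}+o(1)\ \le\ p_n\ \le\ \pi\{\theta:\mathcal D_{\mathfrak F}(\mu_\theta,\mu^*)\le\varepsilon+c_{\mathfrak F}\}+o(1),$$ and if $\pi\{\theta:\mathcal D_{\mathfrak F}(\mu_\theta,\mu^*)=\varepsilon-c_{\mathfrak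 F}\}=0$, then also $$\pi\{\theta:\mathcal D_{\mathfrak F}(\mu_\theta,\mu^*)\le\varepsilon-c_{\mathfrak F}\}+o(1)\ \le\ p_n .$$ Moreover, let $\tilde\varepsilon=\inf\{t>0:\pi\{\theta:\mathcal D_{\mathfrak F}(\mu_\theta,\mu^*)\le t\}>0\}$ and suppose that $\varepsilon>\tilde\varepsilon+c_{\mathfrak F}$. Then there is a constant $\delta>0$ such that, almost surely, $p_n\ge\delta$ for all $n$ large enough; hence, almost surely, the ABC posterior $\pi_n^{(\varepsilon)}$ is a well-defined probability measure for all $n$ large enough; and, almost surely, as $n\to\infty$, $$\pi_n^{(\varepsilon)}\{\theta:\mathcal D_{\mathfrak F}(\mu_\theta,\mu^*)\le\varepsilon+4\mathfrak R_n(\mathfrak F)\}\to1 .$$ -/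

import Mathlib

open MeasureTheory ProbabilityTheory Filter Topology
open scoped ENNReal

/-- Integral probability semimetric of the class `F`, with values in `[0, ∞]`:
`D_F(μ₁, μ₂) = sup_{f ∈ F} |∫ f dμ₁ - ∫ f dμ₂|`. -/
noncomputable def ips {Y : Type*} [MeasurableSpace Y] (F : Set (Y → ℝ)) (μ₁ μ₂ : Measure Y) :
    ℝ≥0∞ :=
  ⨆ f ∈ F, ENNReal.ofReal |(∫ x, f x ∂μ₁) - ∫ x, f x ∂μ₂|

/-- Empirical distribution `n⁻¹ ∑ᵢ δ_{xᵢ}` of a sample `x₁, …, xₙ`. -/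
noncomputable def empiricalMeasure {Y : Type*} [MeasurableSpace Y] {n : ℕ} (x : Fin n → Y) :
    Measure Y :=
  (n : ℝ≥0∞)⁻¹ • ∑ i, Measure.dirac (x i)

/-- `sup_{f ∈ F} |(1/n) ∑ᵢ sᵢ f(xᵢ)|` for a vector of signs `s ∈ {-1, 1}ⁿ`. -/
noncomputable def signedSup {Y : Type*} (F : Set (Y → ℝ)) {n : ℕ} (s : Fin n → ℤˣ)
    (x : Fin n → Y) : ℝ≥0∞ :=
  ⨆ f ∈ F, ENNReal.ofReal |(1 / (n : ℝ)) * ∑ i, (((s i : ℤˣ) : ℤ) : ℝ) * f (x i)|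

/-- Rademacher complexity `R_{μ,n}(F)`: the expectation of `sup_{f ∈ F} |(1/n) ∑ᵢ sᵢ f(xᵢ)|` for
`x₁, …, xₙ` i.i.d. from `μ` and independent i.i.d. Rademacher signs `s`; the latter means that `s`
is uniform on the `2ⁿ` elements of `{-1, 1}ⁿ`. -/
noncomputable def rademacherComplexity {Y : Type*} [MeasurableSpace Y] (F : Set (Y → ℝ))
    (μ : Measure Y) (n : ℕ) : ℝ≥0∞ :=
  ∫⁻ x : Fin n → Y, ((2 : ℝ≥0∞) ^ n)⁻¹ * ∑ s : Fin n → ℤˣ, signedSup F s x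
    ∂(Measure.pi fun _ => μ)

/-- `R_n(F)`: the supremum of `R_{μ,n}(F)` over all probability measures `μ` on `Y`, as a real
number (it is at most `b` when `F` is `b`-uniformly bounded). -/
noncomputable def uniformRademacher {Y : Type*} [MeasurableSpace Y] (F : Set (Y → ℝ)) (n : ℕ) :
    ℝ :=
  (⨆ μ : ProbabilityMeasure Y, rademacherComplexity F (μ : Measure Y) n).toReal

/-- `c_F = 4 limsup_n R_n(F)`. -/
noncomputable def cConst {Y : Type*} [MeasurableSpace Y] (F : Set (Y → ℝ)) : ℝ :=
  4 * limsup (fun n => uniformRademacher F n) atTop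

/-- `D_F(μ_θ, μ*)` as a real number (it is at most `2b` when `F` is `b`-uniformly bounded). -/
noncomputable def modelDiscrepancy {Y Θ : Type*} [MeasurableSpace Y] [MeasurableSpace Θ]
    (F : Set (Y → ℝ)) (model : Kernel Θ Y) (μstar : Measure Y) (θ : Θ) : ℝ :=
  (ips F (model θ) μstar).toReal

/-- `ε̃`: the infimum of the `t > 0` such that `{θ : D_F(μ_θ, μ*) ≤ t}` has positive prior mass. -/
noncomputable def epsTilde {Y Θ : Type*} [MeasurableSpace Y] [MeasurableSpace Θ]
    (F : Set (Y → ℝ)) (model : Kernel Θ Y) (μstar : Measure Y) (prior : Measure Θ) : ℝ :=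
  sInf {t : ℝ | 0 < t ∧ 0 < prior {θ | modelDiscrepancy F model μstar θ ≤ t}}

/-- The probability that `θ` is accepted, given the observed data `y₁, …, yₙ`: the probability that
a synthetic i.i.d. sample `z₁, …, zₙ` from `μ_θ` has `D_F(μ̂_z, μ̂_y) ≤ ε`. -/
noncomputable def acceptGiven {Y Θ : Type*} [MeasurableSpace Y] [MeasurableSpace Θ]
    (F : Set (Y → ℝ)) (model : Kernel Θ Y) (ε : ℝ) {n : ℕ} (y : Fin n → Y) (θ : Θ) : ℝ≥0∞ :=
  (Measure.pi fun _ : Fin n => model θ)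
    {z | ips F (empiricalMeasure z) (empiricalMeasure y) ≤ ENNReal.ofReal ε}

/-- The ABC acceptance probability `p_n`, given the observed data `y₁, …, yₙ`. -/
noncomputable def acceptProb {Y Θ : Type*} [MeasurableSpace Y] [MeasurableSpace Θ]
    (F : Set (Y → ℝ)) (model : Kernel Θ Y) (prior : Measure Θ) (ε : ℝ) {n : ℕ} (y : Fin n → Y) :
    ℝ≥0∞ :=
  ∫⁻ θ, acceptGiven F model ε y θ ∂prior

/-- The ABC posterior: the prior reweighted by the acceptance probability of `θ` and normalized.
It is a probability measure exactly when the normalization is possible. -/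
noncomputable def abcPosterior {Y Θ : Type*} [MeasurableSpace Y] [MeasurableSpace Θ]
    (F : Set (Y → ℝ)) (model : Kernel Θ Y) (prior : Measure Θ) (ε : ℝ) {n : ℕ} (y : Fin n → Y) :
    Measure Θ :=
  (acceptProb F model prior ε y)⁻¹ • prior.withDensity (acceptGiven F model ε y)

/-! Everything rests on a deviation bound that is uniform over the sampling law: for n i.i.d. points
z from any μ, D(μ̂_z, μ) exceeds 2R_n + t with probability at most exp(-n t² / (8b²)). Its
ingredients are symmetrization (the factor 2 in front of R_n) and McDiarmid's inequality.

Uniformity lets the bound serve the synthetic data of every θ at once, and its summability in n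
gives, by Borel–Cantelli, D(μ̂_y, μ*) ≤ 2R_n + t eventually, almost surely. By the triangle
inequality, up to an event of vanishing probability, D(μ̂_z, μ̂_y) and D(μ_θ, μ*) differ by at most
4R_n + 2t. So θ is accepted almost surely in the limit when D(μ_θ, μ*) lies below ε - c_F, and
rejected when it lies above ε + c_F. The prior mass of the shells left between is made small by
continuity of measure (`tendsto_measure_right_shell`, `tendsto_measure_left_shell`).

A leave-one-out average shows that R_n is nonincreasing for n ≥ 1. Hence 4R_n converges to c_F from
above, and {D ≤ ε + 4R_n} contains {D ≤ ε + c_F}. The posterior mass outside is therefore at most a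
vanishing integral divided by the lower bound δ of p_n. -/

/-! ### Bounded differences and McDiarmid's inequality -/

theorem integrable_of_measurable_of_abs_le {α : Type*} [MeasurableSpace α] {μ : Measure α}
    [IsFiniteMeasure μ] {g : α → ℝ} (hg : Measurable g) {B : ℝ} (hB : ∀ x, |g x| ≤ B) :
    Integrable g μ :=
  Integrable.of_bound hg.aestronglyMeasurable B (Eventually.of_forall hB)

theorem abs_integral_le_of_abs_le {α : Type*} [MeasurableSpace α] {μ : Measure α}
    [IsProbabilityMeasure μ] {g : α → ℝ} {B : ℝ} (hB : ∀ x, |g x| ≤ B) : |∫ x, g x ∂μ| ≤ B := by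
  have hB' : ∀ x, ‖g x‖ ≤ B := hB
  simpa using norm_integral_le_of_norm_le_const (μ := μ) (Eventually.of_forall hB')

theorem integral_pi_succ {Y : Type*} [MeasurableSpace Y] (μ : Measure Y) [IsProbabilityMeasure μ]
    {n : ℕ} {g : (Fin (n + 1) → Y) → ℝ} (hg : Measurable g) {B : ℝ} (hB : ∀ x, |g x| ≤ B) :
    ∫ x, g x ∂(Measure.pi fun _ => μ) =
      ∫ v, ∫ z, g (Fin.cons v z) ∂(Measure.pi fun _ : Fin n => μ) ∂μ := by
  have hmp := (measurePreserving_piFinSuccAbove (fun _ : Fin (n + 1) => μ) 0).symm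
  rw [← hmp.integral_comp', integral_prod]
  · simp [MeasurableEquiv.piFinSuccAbove_symm_apply, Fin.insertNthEquiv]
  · exact integrable_of_measurable_of_abs_le (hg.comp (MeasurableEquiv.measurable _))
      fun x => hB _

/-- Peel off one coordinate at a time. Given the first coordinate v, the induction hypothesis
controls the fluctuation of g around its conditional mean G v, and Hoeffding's lemma controls G v
around m; the two exponential bounds multiply. The bound B serves only integrability. -/
theorem integral_exp_le_of_bounded_difference {Y : Type*} [MeasurableSpace Y] (μ : Measure Y)
    [IsProbabilityMeasure μ] {c : ℝ} (t : ℝ) {B : ℝ} (n : ℕ)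
    {g : (Fin n → Y) → ℝ} (hg : Measurable g) (hB : ∀ x, |g x| ≤ B)
    (hdiff : ∀ x i v, |g (Function.update x i v) - g x| ≤ c) :
    ∫ x, Real.exp (t * (g x - ∫ x', g x' ∂(Measure.pi fun _ => μ))) ∂(Measure.pi fun _ => μ) ≤
      Real.exp (n * c ^ 2 * t ^ 2 / 2) := by
  induction n with
  | zero =>
    have h : ∀ x, g x = g Fin.elim0 := fun x => congrArg g (Subsingleton.elim _ _)
    simp [h]
  | succ n ih =>
    set m := ∫ x', g x' ∂(Measure.pi fun _ => μ) with hm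
    set G : Y → ℝ := fun v => ∫ z, g (Fin.cons v z) ∂(Measure.pi fun _ : Fin n => μ) with hG
    have hcons : Measurable fun p : Y × (Fin n → Y) => (Fin.cons p.1 p.2 : Fin (n + 1) → Y) := by
      refine measurable_pi_lambda _ fun i => ?_
      refine Fin.cases ?_ (fun j => ?_) i
      · simpa using measurable_fst
      · simp only [Fin.cons_succ]
        fun_prop
    have hcons' (v : Y) : Measurable fun z : Fin n → Y => (Fin.cons v z : Fin (n + 1) → Y) :=
      hcons.comp measurable_prodMk_left
    have hint (v : Y) : Integrable (fun z => g (Fin.cons v z)) (Measure.pi fun _ : Fin n => μ) :=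
      integrable_of_measurable_of_abs_le (hg.comp (hcons' v)) fun z => hB _
    have hGm : Measurable G :=
      ((hg.comp hcons).stronglyMeasurable.integral_prod_right'
        (ν := Measure.pi fun _ : Fin n => μ)).measurable
    have hmG : m = ∫ v, G v ∂μ := integral_pi_succ μ hg hB
    have hmB : |m| ≤ B := abs_integral_le_of_abs_le hB
    have hGB (v : Y) : |G v| ≤ B :=
      abs_integral_le_of_abs_le fun z => hB (Fin.cons v z)
    have hGdiff (v w : Y) : |G v - G w| ≤ c := by
      rw [hG, ← integral_sub (hint v) (hint w)]
      refine abs_integral_le_of_abs_le fun z => ?_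
      simpa [Fin.update_cons_zero] using hdiff (Fin.cons w z) 0 v
    have hexpB {a d : ℝ} (ha : |a| ≤ B) (hd : |d| ≤ B) :
        |Real.exp (t * (a - d))| ≤ Real.exp (|t| * (B + B)) := by
      rw [Real.abs_exp]
      refine Real.exp_le_exp.2 ((le_abs_self _).trans ?_)
      rw [abs_mul]
      exact mul_le_mul_of_nonneg_left ((abs_sub _ _).trans (add_le_add ha hd)) (abs_nonneg t)
    have hem : Measurable fun x => Real.exp (t * (g x - m)) := by fun_prop
    rw [integral_pi_succ μ hem fun x => hexpB (hB x) hmB]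
    have hinner (v : Y) : ∫ z, Real.exp (t * (g (Fin.cons v z) - m))
        ∂(Measure.pi fun _ : Fin n => μ) ≤
        Real.exp (t * (G v - m)) * Real.exp (n * c ^ 2 * t ^ 2 / 2) := by
      have h1 (z : Fin n → Y) : Real.exp (t * (g (Fin.cons v z) - m)) =
          Real.exp (t * (G v - m)) * Real.exp (t * (g (Fin.cons v z) - G v)) := by
        rw [← Real.exp_add]; ring_nf
      simp_rw [h1, integral_const_mul]
      refine mul_le_mul_of_nonneg_left ?_ (Real.exp_nonneg _)
      refine ih (hg.comp (hcons' v)) (fun z => hB _) fun z i w => ?_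
      simpa [Fin.cons_update] using hdiff (Fin.cons v z) i.succ w
    have hGe : Integrable (fun v => Real.exp (t * (G v - m))) μ :=
      integrable_of_measurable_of_abs_le (by fun_prop) fun v => hexpB (hGB v) hmB
    have hmgf : ∫ v, Real.exp (t * (G v - m)) ∂μ ≤ Real.exp (c ^ 2 * t ^ 2 / 2) := by
      -- G takes values in an interval of length 2c centred at an arbitrary reference value.
      -- Avoiding the extrema of G costs a factor 4 in the variance proxy, which is harmless here.
      obtain ⟨v₀⟩ : Nonempty Y := μ.nonempty_of_neZero
      have := (hasSubgaussianMGF_of_mem_Icc (μ := μ) (X := G) (a := G v₀ - c) (b := G v₀ + c)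
        hGm.aemeasurable (Eventually.of_forall fun v => by
          have := abs_le.1 (hGdiff v v₀)
          constructor <;> linarith)).mgf_le t
      rw [mgf, ← hmG] at this
      refine this.trans (le_of_eq ?_)
      have h2 : G v₀ + c - (G v₀ - c) = c * 2 := by ring
      simp [h2]
    calc _ ≤ ∫ v, Real.exp (t * (G v - m)) * Real.exp (n * c ^ 2 * t ^ 2 / 2) ∂μ := by
            refine integral_mono ?_ (hGe.mul_const _) hinner
            refine integrable_of_measurable_of_abs_le
              (((hem.comp hcons).stronglyMeasurable.integral_prod_right'
                (ν := Measure.pi fun _ : Fin n => μ)).measurable)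
              (B := Real.exp (|t| * (B + B))) fun v =>
                abs_integral_le_of_abs_le fun z => hexpB (hB (Fin.cons v z)) hmB
      _ ≤ Real.exp (c ^ 2 * t ^ 2 / 2) * Real.exp (n * c ^ 2 * t ^ 2 / 2) := by
            rw [integral_mul_const]
            exact mul_le_mul_of_nonneg_right hmgf (Real.exp_nonneg _)
      _ = Real.exp ((n + 1 : ℕ) * c ^ 2 * t ^ 2 / 2) := by
            rw [← Real.exp_add]; push_cast; ring_nf

/-- McDiarmid's inequality for i.i.d. coordinates. -/
theorem measure_pi_bounded_difference_le {Y : Type*} [MeasurableSpace Y] (μ : Measure Y)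
    [IsProbabilityMeasure μ] {c : ℝ} {B : ℝ} {n : ℕ}
    {g : (Fin n → Y) → ℝ} (hg : Measurable g) (hB : ∀ x, |g x| ≤ B)
    (hdiff : ∀ x i v, |g (Function.update x i v) - g x| ≤ c) {t : ℝ} (ht : 0 ≤ t) :
    (Measure.pi fun _ => μ) {x | ∫ x', g x' ∂(Measure.pi fun _ => μ) + t ≤ g x} ≤
      ENNReal.ofReal (Real.exp (-t ^ 2 / (2 * (n * c ^ 2)))) := by
  set m := ∫ x', g x' ∂(Measure.pi fun _ => μ) with hm
  have hsub : HasSubgaussianMGF (fun x => g x - m) ⟨n * c ^ 2, by positivity⟩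
      (Measure.pi fun _ => μ) := by
    refine ⟨fun s => integrable_of_measurable_of_abs_le (by fun_prop)
      (B := Real.exp (|s| * (B + |m|))) fun x => ?_, fun s => ?_⟩
    · rw [Real.abs_exp]
      refine Real.exp_le_exp.2 ((le_abs_self _).trans ?_)
      rw [abs_mul]
      exact mul_le_mul_of_nonneg_left ((abs_sub _ _).trans (add_le_add_left (hB x) _))
        (abs_nonneg s)
    · exact integral_exp_le_of_bounded_difference μ s n hg hB hdiff
  have h := hsub.measure_ge_le ht
  have hset : {x | m + t ≤ g x} = {x | t ≤ g x - m} := by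
    ext x; simp [le_sub_iff_add_le']
  rw [hset, ← ofReal_measureReal]
  exact ENNReal.ofReal_le_ofReal h

/-! ### The semimetric and empirical measures -/

section Semimetric

variable {Y : Type*} [MeasurableSpace Y] {F : Set (Y → ℝ)}

theorem ips_comm (μ ν : Measure Y) : ips F μ ν = ips F ν μ := by
  simp only [ips, abs_sub_comm]

theorem ofReal_le_ips {μ ν : Measure Y} {f : Y → ℝ} (hf : f ∈ F) :
    ENNReal.ofReal |(∫ x, f x ∂μ) - ∫ x, f x ∂ν| ≤ ips F μ ν :=
  le_iSup₂_of_le f hf le_rfl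

theorem ips_le_ofReal {μ ν : Measure Y} {a : ℝ}
    (h : ∀ f ∈ F, |(∫ x, f x ∂μ) - ∫ x, f x ∂ν| ≤ a) : ips F μ ν ≤ ENNReal.ofReal a :=
  iSup₂_le fun f hf => ENNReal.ofReal_le_ofReal (h f hf)

theorem ips_triangle (μ ν ρ : Measure Y) : ips F μ ρ ≤ ips F μ ν + ips F ν ρ := by
  refine iSup₂_le fun f hf => ?_
  calc ENNReal.ofReal |(∫ x, f x ∂μ) - ∫ x, f x ∂ρ|
      ≤ ENNReal.ofReal (|(∫ x, f x ∂μ) - ∫ x, f x ∂ν| + |(∫ x, f x ∂ν) - ∫ x, f x ∂ρ|) :=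
        ENNReal.ofReal_le_ofReal (abs_sub_le _ _ _)
    _ = _ := ENNReal.ofReal_add (abs_nonneg _) (abs_nonneg _)
    _ ≤ _ := add_le_add (ofReal_le_ips hf) (ofReal_le_ips hf)

theorem integral_empiricalMeasure {n : ℕ} (x : Fin n → Y) {f : Y → ℝ} (hf : Measurable f) :
    ∫ v, f v ∂(empiricalMeasure x) = 1 / (n : ℝ) * ∑ i, f (x i) := by
  rw [empiricalMeasure, integral_smul_measure, integral_finsetSum_measure]
  · simp [integral_dirac' _ _ hf.stronglyMeasurable]
  · intro i _
    exact (integrable_dirac' hf.stronglyMeasurable (by simp))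

theorem abs_integral_empiricalMeasure_le {n : ℕ} (x : Fin n → Y) {f : Y → ℝ}
    (hf : Measurable f) {b : ℝ} (hb : 0 ≤ b) (hfb : ∀ v, |f v| ≤ b) :
    |∫ v, f v ∂(empiricalMeasure x)| ≤ b := by
  rw [integral_empiricalMeasure x hf, abs_mul]
  rcases Nat.eq_zero_or_pos n with rfl | hn
  · simpa using hb
  have hn' : (0 : ℝ) < n := by exact_mod_cast hn
  have h : |∑ i, f (x i)| ≤ n * b :=
    (Finset.abs_sum_le_sum_abs _ _).trans
      ((Finset.sum_le_sum fun i _ => hfb (x i)).trans (by simp))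
  calc |1 / (n : ℝ)| * |∑ i, f (x i)| ≤ 1 / (n : ℝ) * (n * b) := by
        rw [abs_of_pos (by positivity)]
        exact mul_le_mul_of_nonneg_left h (by positivity)
    _ = b := by field_simp

theorem ips_empiricalMeasure (hF : ∀ f ∈ F, Measurable f) {n : ℕ} (z z' : Fin n → Y) :
    ips F (empiricalMeasure z) (empiricalMeasure z') =
      ⨆ f ∈ F, ENNReal.ofReal |1 / (n : ℝ) * ∑ i, (f (z i) - f (z' i))| := by
  refine iSup_congr fun f => iSup_congr fun hf => ?_
  rw [integral_empiricalMeasure z (hF f hf), integral_empiricalMeasure z' (hF f hf),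
    ← mul_sub, Finset.sum_sub_distrib]

theorem ips_empiricalMeasure_le (hF : ∀ f ∈ F, Measurable f) {b : ℝ} (hb : 0 ≤ b)
    (hFb : ∀ f ∈ F, ∀ x, |f x| ≤ b) {n : ℕ} (z z' : Fin n → Y) :
    ips F (empiricalMeasure z) (empiricalMeasure z') ≤ ENNReal.ofReal (2 * b) := by
  refine ips_le_ofReal fun f hf => (abs_sub _ _).trans ?_
  rw [two_mul]
  exact add_le_add (abs_integral_empiricalMeasure_le z (hF f hf) hb (hFb f hf))
    (abs_integral_empiricalMeasure_le z' (hF f hf) hb (hFb f hf))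

theorem ips_le_of_abs_le {b : ℝ} (hFb : ∀ f ∈ F, ∀ x, |f x| ≤ b) (μ ν : Measure Y)
    [IsProbabilityMeasure μ] [IsProbabilityMeasure ν] : ips F μ ν ≤ ENNReal.ofReal (2 * b) := by
  refine ips_le_ofReal fun f hf => (abs_sub _ _).trans ?_
  rw [two_mul]
  exact add_le_add (abs_integral_le_of_abs_le (hFb f hf)) (abs_integral_le_of_abs_le (hFb f hf))

theorem ips_empiricalMeasure_update_le (hF : ∀ f ∈ F, Measurable f) {b : ℝ}
    (hFb : ∀ f ∈ F, ∀ x, |f x| ≤ b) {n : ℕ} (z : Fin n → Y) (i : Fin n) (v : Y) :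
    ips F (empiricalMeasure (Function.update z i v)) (empiricalMeasure z) ≤
      ENNReal.ofReal (2 * b / n) := by
  rw [ips_empiricalMeasure hF]
  refine iSup₂_le fun f hf => ENNReal.ofReal_le_ofReal ?_
  rw [Finset.sum_eq_single i (fun j _ hj => by simp [hj]) (by simp), abs_mul,
    abs_of_nonneg (by positivity), div_mul_eq_mul_div, one_mul]
  refine div_le_div_of_nonneg_right ((abs_sub _ _).trans ?_) (by positivity)
  rw [two_mul]
  exact add_le_add (hFb f hf _) (hFb f hf _)

end Semimetric

/-! ### Symmetrization and monotonicity of Rademacher complexity -/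

section Rademacher

variable {Y : Type*} [MeasurableSpace Y] {F : Set (Y → ℝ)}

theorem rademacherComplexity_eq_sum
    (hsign : ∀ (n : ℕ) (s : Fin n → ℤˣ), Measurable (signedSup F s)) (μ : Measure Y) (n : ℕ) :
    rademacherComplexity F μ n = ((2 : ℝ≥0∞) ^ n)⁻¹ *
      ∑ s : Fin n → ℤˣ, ∫⁻ x, signedSup F s x ∂(Measure.pi fun _ => μ) := by
  rw [rademacherComplexity, lintegral_const_mul _ (Finset.measurable_fun_sum _ fun s _ => hsign n s),
    lintegral_finsetSum _ fun s _ => hsign n s]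

theorem card_signs (n : ℕ) : Fintype.card (Fin n → ℤˣ) = 2 ^ n := by
  simp [Fintype.card_units_int]

/-- Exchanging the two members of the pairs whose sign is negative. -/
def signSwap {α : Type*} (u : ℤˣ) : α × α → α × α := if u = 1 then id else Prod.swap

theorem measurePreserving_signSwap (μ : Measure Y) [SFinite μ] (u : ℤˣ) :
    MeasurePreserving (signSwap u) (μ.prod μ) (μ.prod μ) := by
  unfold signSwap
  split_ifs
  · exact MeasurePreserving.id _
  · exact Measure.measurePreserving_swap

theorem sub_signSwap {α : Type*} (f : α → ℝ) (u : ℤˣ) (p : α × α) :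
    f (signSwap u p).1 - f (signSwap u p).2 = ((u : ℤ) : ℝ) * (f p.1 - f p.2) := by
  rcases Int.units_eq_one_or u with rfl | rfl <;> simp [signSwap]

theorem ips_signSwap_le (hF : ∀ f ∈ F, Measurable f) {n : ℕ} (s : Fin n → ℤˣ)
    (w : Fin n → Y × Y) :
    ips F (empiricalMeasure fun i => (signSwap (s i) (w i)).1)
        (empiricalMeasure fun i => (signSwap (s i) (w i)).2) ≤
      signedSup F s (fun i => (w i).1) + signedSup F s (fun i => (w i).2) := by
  rw [ips_empiricalMeasure hF]
  refine iSup₂_le fun f hf => ?_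
  simp_rw [sub_signSwap, mul_sub, Finset.sum_sub_distrib, mul_sub]
  refine (ENNReal.ofReal_le_ofReal (abs_sub _ _)).trans ?_
  rw [ENNReal.ofReal_add (abs_nonneg _) (abs_nonneg _)]
  exact add_le_add (le_iSup₂_of_le f hf le_rfl) (le_iSup₂_of_le f hf le_rfl)

/-- Symmetrization. -/
theorem lintegral_ips_empiricalMeasure_le (hF : ∀ f ∈ F, Measurable f)
    (hsign : ∀ (n : ℕ) (s : Fin n → ℤˣ), Measurable (signedSup F s))
    (hemp : ∀ n : ℕ, Measurable fun q : (Fin n → Y) × (Fin n → Y) =>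
      ips F (empiricalMeasure q.1) (empiricalMeasure q.2))
    (μ : Measure Y) [IsProbabilityMeasure μ] (n : ℕ) :
    ∫⁻ q, ips F (empiricalMeasure q.1) (empiricalMeasure q.2)
        ∂((Measure.pi fun _ : Fin n => μ).prod (Measure.pi fun _ : Fin n => μ)) ≤
      2 * rademacherComplexity F μ n := by
  set J := ∫⁻ q, ips F (empiricalMeasure q.1) (empiricalMeasure q.2)
        ∂((Measure.pi fun _ : Fin n => μ).prod (Measure.pi fun _ : Fin n => μ)) with hJ
  have hpair : J = ∫⁻ w : Fin n → Y × Y, ips F (empiricalMeasure fun i => (w i).1)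
      (empiricalMeasure fun i => (w i).2) ∂(Measure.pi fun _ => μ.prod μ) :=
    ((measurePreserving_arrowProdEquivProdArrow Y Y (Fin n) (fun _ => μ)
      (fun _ => μ)).lintegral_comp (hemp n)).symm
  have hfst : MeasurePreserving (fun (w : Fin n → Y × Y) i => (w i).1)
      (Measure.pi fun _ => μ.prod μ) (Measure.pi fun _ => μ) :=
    measurePreserving_pi _ _ fun _ => measurePreserving_fst
  have hsnd : MeasurePreserving (fun (w : Fin n → Y × Y) i => (w i).2)
      (Measure.pi fun _ => μ.prod μ) (Measure.pi fun _ => μ) :=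
    measurePreserving_pi _ _ fun _ => measurePreserving_snd
  -- For each fixed sign vector, swapping the pairs with negative sign preserves the joint law and
  -- turns the differences into signed differences. Averaging over all signs comes only afterwards.
  have hJs (s : Fin n → ℤˣ) : J ≤ 2 * ∫⁻ x, signedSup F s x ∂(Measure.pi fun _ => μ) := by
    have hsw : MeasurePreserving (fun (w : Fin n → Y × Y) i => signSwap (s i) (w i))
        (Measure.pi fun _ => μ.prod μ) (Measure.pi fun _ => μ.prod μ) :=
      measurePreserving_pi _ _ fun i => measurePreserving_signSwap μ (s i)
    have hmeas : Measurable fun w : Fin n → Y × Y => ips F (empiricalMeasure fun i => (w i).1)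
        (empiricalMeasure fun i => (w i).2) :=
      Measurable.comp (g := fun q : (Fin n → Y) × (Fin n → Y) =>
        ips F (empiricalMeasure q.1) (empiricalMeasure q.2))
        (f := fun w : Fin n → Y × Y => (fun i => (w i).1, fun i => (w i).2))
        (hemp n) (hfst.measurable.prodMk hsnd.measurable)
    rw [hpair, ← hsw.lintegral_comp hmeas]
    refine (lintegral_mono fun w => ips_signSwap_le hF s w).trans ?_
    have hsf : Measurable fun w : Fin n → Y × Y => signedSup F s fun i => (w i).1 :=
      (hsign n s).comp hfst.measurable
    rw [lintegral_add_left hsf, hfst.lintegral_comp (hsign n s), hsnd.lintegral_comp (hsign n s), two_mul]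
  have h2 : ((2 : ℝ≥0∞) ^ n)⁻¹ * 2 ^ n = 1 :=
    ENNReal.inv_mul_cancel (by simp) (by simp)
  calc J = ((2 : ℝ≥0∞) ^ n)⁻¹ * ∑ _s : Fin n → ℤˣ, J := by
        rw [Finset.sum_const, Finset.card_univ, card_signs, nsmul_eq_mul, ← mul_assoc]
        push_cast
        rw [h2, one_mul]
    _ ≤ ((2 : ℝ≥0∞) ^ n)⁻¹ *
          ∑ s : Fin n → ℤˣ, 2 * ∫⁻ x, signedSup F s x ∂(Measure.pi fun _ => μ) := by
        gcongr with s
        exact hJs s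
    _ = 2 * rademacherComplexity F μ n := by
        rw [rademacherComplexity_eq_sum hsign, ← Finset.mul_sum, mul_left_comm]

/-- A mean of n + 1 terms is the average of its n + 1 leave-one-out means, and a supremum of
averages is at most the average of suprema. For n = 0 the leave-one-out means are 0 by the
convention 1 / 0 = 0, and the identity fails. -/
theorem signedSup_succ_le {α : Type*} {F : Set (α → ℝ)} {n : ℕ} (hn : n ≠ 0)
    (s : Fin (n + 1) → ℤˣ) (x : Fin (n + 1) → α) :
    signedSup F s x ≤ ((n + 1 : ℕ) : ℝ≥0∞)⁻¹ *
      ∑ j : Fin (n + 1), signedSup F (fun i => s (j.succAbove i)) fun i => x (j.succAbove i) := by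
  refine iSup₂_le fun f hf => ?_
  set a : Fin (n + 1) → ℝ := fun i => ((s i : ℤ) : ℝ) * f (x i) with ha
  have hn' : (n : ℝ) ≠ 0 := by exact_mod_cast hn
  have hloo : 1 / ((n + 1 : ℕ) : ℝ) * ∑ i, a i =
      ((n + 1 : ℕ) : ℝ)⁻¹ * ∑ j : Fin (n + 1), 1 / (n : ℝ) * ∑ i, a (j.succAbove i) := by
    have h (j : Fin (n + 1)) : ∑ i, a (j.succAbove i) = ∑ i, a i - a j := by
      rw [Fin.sum_univ_succAbove a j]; ring
    simp_rw [h, ← Finset.mul_sum, Finset.sum_sub_distrib]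
    rw [Finset.sum_const, Finset.card_univ, Fintype.card_fin, nsmul_eq_mul]
    push_cast
    field_simp
    ring
  rw [hloo, abs_mul, abs_of_nonneg (by positivity), ENNReal.ofReal_mul (by positivity),
    ENNReal.ofReal_inv_of_pos (by positivity), ENNReal.ofReal_natCast]
  gcongr
  refine (ENNReal.ofReal_le_ofReal (Finset.abs_sum_le_sum_abs _ _)).trans ?_
  rw [ENNReal.ofReal_sum_of_nonneg fun _ _ => abs_nonneg _]
  exact Finset.sum_le_sum fun j _ => le_iSup₂_of_le f hf le_rfl

theorem rademacherComplexity_succ_le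
    (hsign : ∀ (n : ℕ) (s : Fin n → ℤˣ), Measurable (signedSup F s))
    (μ : Measure Y) [IsProbabilityMeasure μ] {n : ℕ} (hn : n ≠ 0) :
    rademacherComplexity F μ (n + 1) ≤ rademacherComplexity F μ n := by
  rw [rademacherComplexity_eq_sum hsign, rademacherComplexity_eq_sum hsign]
  set A : (Fin n → ℤˣ) → ℝ≥0∞ := fun s => ∫⁻ x, signedSup F s x ∂(Measure.pi fun _ => μ) with hA
  have hmp (j : Fin (n + 1)) : MeasurePreserving
      (fun (x : Fin (n + 1) → Y) i => x (j.succAbove i))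
      (Measure.pi fun _ => μ) (Measure.pi fun _ => μ) :=
    measurePreserving_snd.comp (measurePreserving_piFinSuccAbove (fun _ => μ) j)
  have hs (s : Fin (n + 1) → ℤˣ) : ∫⁻ x, signedSup F s x ∂(Measure.pi fun _ => μ) ≤
      ((n + 1 : ℕ) : ℝ≥0∞)⁻¹ * ∑ j : Fin (n + 1), A fun i => s (j.succAbove i) := by
    refine (lintegral_mono fun x => signedSup_succ_le hn s x).trans_eq ?_
    have hm (j : Fin (n + 1)) : Measurable fun x : Fin (n + 1) → Y =>
        signedSup F (fun i => s (j.succAbove i)) fun i => x (j.succAbove i) :=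
      (hsign n _).comp (hmp j).measurable
    rw [lintegral_const_mul _ (Finset.measurable_fun_sum _ fun j _ => hm j),
      lintegral_finsetSum _ fun j _ => hm j]
    congr 1
    exact Finset.sum_congr rfl fun j _ => (hmp j).lintegral_comp (hsign n _)
  -- Each sign vector of length n extends to length n + 1 in two ways; this 2 cancels against the
  -- normalization.
  have hsum (j : Fin (n + 1)) :
      ∑ s : Fin (n + 1) → ℤˣ, A (fun i => s (j.succAbove i)) = 2 * ∑ s, A s := by
    rw [← (Fin.insertNthEquiv (fun _ => ℤˣ) j).sum_comp, Fintype.sum_prod_type]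
    simp [Fin.insertNthEquiv]
  calc _ ≤ ((2 : ℝ≥0∞) ^ (n + 1))⁻¹ * ∑ s : Fin (n + 1) → ℤˣ,
          ((n + 1 : ℕ) : ℝ≥0∞)⁻¹ * ∑ j : Fin (n + 1), A fun i => s (j.succAbove i) := by
        gcongr with s
        exact hs s
    _ = ((2 : ℝ≥0∞) ^ (n + 1))⁻¹ * (2 * ∑ s, A s) := by
        rw [← Finset.mul_sum, Finset.sum_comm]
        simp_rw [hsum]
        rw [Finset.sum_const, Finset.card_univ, Fintype.card_fin, nsmul_eq_mul,
          ← mul_assoc (_ : ℝ≥0∞)⁻¹ (_ : ℝ≥0∞) (2 * ∑ s, A s),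
          ENNReal.inv_mul_cancel (by simp) (by simp), one_mul]
    _ = ((2 : ℝ≥0∞) ^ n)⁻¹ * ∑ s, A s := by
        rw [← mul_assoc, pow_succ, ENNReal.mul_inv (by simp) (by simp), mul_assoc _ 2⁻¹,
          ENNReal.inv_mul_cancel (by simp) (by simp), mul_one]

theorem signedSup_le {α : Type*} {F : Set (α → ℝ)} {b : ℝ} (hb : 0 ≤ b) (hFb : ∀ f ∈ F, ∀ x, |f x| ≤ b)
    {n : ℕ} (s : Fin n → ℤˣ) (x : Fin n → α) : signedSup F s x ≤ ENNReal.ofReal b := by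
  refine iSup₂_le fun f hf => ENNReal.ofReal_le_ofReal ?_
  rcases Nat.eq_zero_or_pos n with rfl | hn
  · simpa using hb
  have hn' : (0 : ℝ) < n := by exact_mod_cast hn
  have habs (i : Fin n) : |((s i : ℤ) : ℝ) * f (x i)| ≤ b := by
    rcases Int.units_eq_one_or (s i) with h | h <;> simpa [h] using hFb f hf (x i)
  have h : |∑ i, ((s i : ℤ) : ℝ) * f (x i)| ≤ n * b :=
    (Finset.abs_sum_le_sum_abs _ _).trans
      ((Finset.sum_le_sum fun i _ => habs i).trans (by simp))
  calc |1 / (n : ℝ) * ∑ i, ((s i : ℤ) : ℝ) * f (x i)| ≤ 1 / (n : ℝ) * (n * b) := by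
        rw [abs_mul, abs_of_pos (by positivity)]
        exact mul_le_mul_of_nonneg_left h (by positivity)
    _ = b := by field_simp

theorem rademacherComplexity_le {b : ℝ} (hb : 0 ≤ b) (hFb : ∀ f ∈ F, ∀ x, |f x| ≤ b)
    (μ : Measure Y) [IsProbabilityMeasure μ] (n : ℕ) :
    rademacherComplexity F μ n ≤ ENNReal.ofReal b := by
  have h (x : Fin n → Y) :
      ((2 : ℝ≥0∞) ^ n)⁻¹ * ∑ s : Fin n → ℤˣ, signedSup F s x ≤ ENNReal.ofReal b := by
    calc _ ≤ ((2 : ℝ≥0∞) ^ n)⁻¹ * ∑ _s : Fin n → ℤˣ, ENNReal.ofReal b := by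
          gcongr with s
          exact signedSup_le hb hFb s x
      _ = ENNReal.ofReal b := by
          rw [Finset.sum_const, Finset.card_univ, card_signs, nsmul_eq_mul, ← mul_assoc]
          push_cast
          rw [ENNReal.inv_mul_cancel (by simp) (by simp), one_mul]
  refine (lintegral_mono h).trans ?_
  simp

theorem iSup_rademacherComplexity_ne_top {b : ℝ} (hb : 0 ≤ b) (hFb : ∀ f ∈ F, ∀ x, |f x| ≤ b)
    (n : ℕ) : ⨆ μ : ProbabilityMeasure Y, rademacherComplexity F (μ : Measure Y) n ≠ ∞ :=
  ne_top_of_le_ne_top ENNReal.ofReal_ne_top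
    (iSup_le fun μ => rademacherComplexity_le hb hFb (μ : Measure Y) n)

theorem rademacherComplexity_le_ofReal {b : ℝ} (hb : 0 ≤ b) (hFb : ∀ f ∈ F, ∀ x, |f x| ≤ b)
    (μ : Measure Y) [IsProbabilityMeasure μ] (n : ℕ) :
    rademacherComplexity F μ n ≤ ENNReal.ofReal (uniformRademacher F n) := by
  rw [uniformRademacher, ENNReal.ofReal_toReal (iSup_rademacherComplexity_ne_top hb hFb n)]
  exact le_iSup (fun ν : ProbabilityMeasure Y => rademacherComplexity F (ν : Measure Y) n)
    ⟨μ, inferInstance⟩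

theorem uniformRademacher_nonneg (n : ℕ) : 0 ≤ uniformRademacher F n := ENNReal.toReal_nonneg

/-- The shift by one excludes n = 0, where the complexity is 0 by convention. -/
theorem antitone_uniformRademacher_succ {b : ℝ} (hb : 0 ≤ b) (hFb : ∀ f ∈ F, ∀ x, |f x| ≤ b)
    (hsign : ∀ (n : ℕ) (s : Fin n → ℤˣ), Measurable (signedSup F s)) :
    Antitone fun n => uniformRademacher F (n + 1) := by
  refine antitone_nat_of_succ_le fun n => ?_
  refine ENNReal.toReal_mono (iSup_rademacherComplexity_ne_top hb hFb _) ?_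
  exact iSup_mono fun μ => rademacherComplexity_succ_le hsign (μ : Measure Y) n.succ_ne_zero

theorem tendsto_uniformRademacher {b : ℝ} (hb : 0 ≤ b) (hFb : ∀ f ∈ F, ∀ x, |f x| ≤ b)
    (hsign : ∀ (n : ℕ) (s : Fin n → ℤˣ), Measurable (signedSup F s)) :
    Tendsto (fun n => 4 * uniformRademacher F n) atTop (𝓝 (cConst F)) := by
  have h := tendsto_atTop_ciInf (antitone_uniformRademacher_succ hb hFb hsign)
    ⟨0, by rintro _ ⟨n, rfl⟩; exact uniformRademacher_nonneg _⟩
  have h' := (tendsto_add_atTop_iff_nat 1).1 h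
  rw [cConst, h'.limsup_eq]
  exact h'.const_mul 4

/-- A nonincreasing sequence stays above its limit. This is what allows the radius ε + 4R_n in the
concentration of the posterior. -/
theorem cConst_le {b : ℝ} (hb : 0 ≤ b) (hFb : ∀ f ∈ F, ∀ x, |f x| ≤ b)
    (hsign : ∀ (n : ℕ) (s : Fin n → ℤˣ), Measurable (signedSup F s)) {n : ℕ} (hn : n ≠ 0) :
    cConst F ≤ 4 * uniformRademacher F n := by
  obtain ⟨m, rfl⟩ := Nat.exists_eq_succ_of_ne_zero hn
  refine le_of_tendsto (tendsto_uniformRademacher hb hFb hsign) ?_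
  filter_upwards [eventually_ge_atTop (m + 1)] with k hk
  obtain ⟨l, rfl⟩ := Nat.exists_eq_add_of_le' (show 1 ≤ k by omega)
  have := antitone_uniformRademacher_succ hb hFb hsign (show m ≤ l by omega)
  simpa using this

end Rademacher

/-! ### Uniform concentration of empirical measures -/

section Concentration

variable {Y : Type*} [MeasurableSpace Y] {F : Set (Y → ℝ)}

/-- Averaging over a ghost sample bounds the distance to the sampling distribution. -/
theorem ips_empiricalMeasure_le_integral (hF : ∀ f ∈ F, Measurable f) {b : ℝ} (hb : 0 ≤ b)
    (hFb : ∀ f ∈ F, ∀ x, |f x| ≤ b)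
    (hemp : ∀ n : ℕ, Measurable fun q : (Fin n → Y) × (Fin n → Y) =>
      ips F (empiricalMeasure q.1) (empiricalMeasure q.2))
    (μ : Measure Y) [IsProbabilityMeasure μ] {n : ℕ} (hn : n ≠ 0) (z : Fin n → Y) :
    ips F (empiricalMeasure z) μ ≤
      ENNReal.ofReal (∫ z', (ips F (empiricalMeasure z) (empiricalMeasure z')).toReal
        ∂(Measure.pi fun _ : Fin n => μ)) := by
  have hn' : (n : ℝ) ≠ 0 := by exact_mod_cast hn
  refine ips_le_ofReal fun f hf => ?_
  have hfi (i : Fin n) : Integrable (fun z' : Fin n → Y => f (z' i)) (Measure.pi fun _ => μ) :=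
    integrable_of_measurable_of_abs_le ((hF f hf).comp (measurable_pi_apply i)) fun _ => hFb f hf _
  have hmean : ∫ v, f v ∂μ = ∫ z' : Fin n → Y, ∫ v, f v ∂(empiricalMeasure z')
      ∂(Measure.pi fun _ => μ) := by
    simp_rw [fun z' : Fin n → Y => integral_empiricalMeasure z' (hF f hf)]
    rw [integral_const_mul, integral_finsetSum _ fun i _ => hfi i]
    have h (i : Fin n) : ∫ z' : Fin n → Y, f (z' i) ∂(Measure.pi fun _ => μ) = ∫ v, f v ∂μ :=
      integral_comp_eval (μ := fun _ : Fin n => μ) (hF f hf).aestronglyMeasurable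
    simp_rw [h]
    simp [hn']
  have hint : Integrable (fun z' : Fin n → Y => ∫ v, f v ∂(empiricalMeasure z'))
      (Measure.pi fun _ => μ) := by
    simp_rw [fun z' : Fin n → Y => integral_empiricalMeasure z' (hF f hf)]
    exact (integrable_finsetSum _ fun i _ => hfi i).const_mul _
  have hsub : (∫ v, f v ∂(empiricalMeasure z)) - ∫ v, f v ∂μ =
      ∫ z' : Fin n → Y, (∫ v, f v ∂(empiricalMeasure z)) - ∫ v, f v ∂(empiricalMeasure z')
        ∂(Measure.pi fun _ => μ) := by
    rw [integral_sub (integrable_const _) hint, ← hmean]; simp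
  rw [hsub]
  -- Jensen's inequality: the deviation is a mean over the ghost sample, so its absolute value is at
  -- most the mean absolute value.
  refine (abs_integral_le_integral_abs).trans (integral_mono ?_ ?_ fun z' => ?_)
  · exact ((integrable_const _).sub hint).abs
  · refine integrable_of_measurable_of_abs_le
      ((hemp n).comp measurable_prodMk_left).ennreal_toReal (B := 2 * b) fun z' => ?_
    rw [abs_of_nonneg ENNReal.toReal_nonneg]
    exact ENNReal.toReal_le_of_le_ofReal (by positivity) (ips_empiricalMeasure_le hF hb hFb _ _)
  · refine (ENNReal.ofReal_le_iff_le_toReal ?_).1 (ofReal_le_ips hf)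
    exact ne_top_of_le_ne_top ENNReal.ofReal_ne_top (ips_empiricalMeasure_le hF hb hFb _ _)

/-- McDiarmid is applied not to D(μ̂_z, μ) but to its ghost-sample majorant H. Measurability of H
follows from that of the distance between two empirical measures, its mean is bounded by
symmetrization, and changing one point moves it by at most 2b/n. The deviation event itself need not
be measurable: it is contained in a measurable one. -/
theorem measure_pi_lt_ips_empiricalMeasure_le (hF : ∀ f ∈ F, Measurable f) {b : ℝ} (hb : 0 ≤ b)
    (hFb : ∀ f ∈ F, ∀ x, |f x| ≤ b)
    (hsign : ∀ (n : ℕ) (s : Fin n → ℤˣ), Measurable (signedSup F s))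
    (hemp : ∀ n : ℕ, Measurable fun q : (Fin n → Y) × (Fin n → Y) =>
      ips F (empiricalMeasure q.1) (empiricalMeasure q.2))
    (μ : Measure Y) [IsProbabilityMeasure μ] {n : ℕ} (hn : n ≠ 0) {t : ℝ} (ht : 0 ≤ t) :
    (Measure.pi fun _ : Fin n => μ)
        {z | ENNReal.ofReal (2 * uniformRademacher F n + t) < ips F (empiricalMeasure z) μ} ≤
      ENNReal.ofReal (Real.exp (-t ^ 2 / (2 * (n * (2 * b / n) ^ 2)))) := by
  set H : (Fin n → Y) → ℝ := fun z => ∫ z', (ips F (empiricalMeasure z) (empiricalMeasure z')).toReal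
        ∂(Measure.pi fun _ : Fin n => μ) with hH
  have hle (z z' : Fin n → Y) : |(ips F (empiricalMeasure z) (empiricalMeasure z')).toReal|
      ≤ 2 * b := by
    rw [abs_of_nonneg ENNReal.toReal_nonneg]
    exact ENNReal.toReal_le_of_le_ofReal (by positivity) (ips_empiricalMeasure_le hF hb hFb _ _)
  have hfin (z z' : Fin n → Y) : ips F (empiricalMeasure z) (empiricalMeasure z') ≠ ∞ :=
    ne_top_of_le_ne_top ENNReal.ofReal_ne_top (ips_empiricalMeasure_le hF hb hFb _ _)
  have hint (z : Fin n → Y) : Integrable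
      (fun z' => (ips F (empiricalMeasure z) (empiricalMeasure z')).toReal)
      (Measure.pi fun _ : Fin n => μ) :=
    integrable_of_measurable_of_abs_le
      ((hemp n).comp measurable_prodMk_left).ennreal_toReal (hle z)
  have hHm : Measurable H :=
    ((hemp n).ennreal_toReal.stronglyMeasurable.integral_prod_right'
      (ν := Measure.pi fun _ : Fin n => μ)).measurable
  have hHB (z : Fin n → Y) : |H z| ≤ 2 * b := abs_integral_le_of_abs_le (hle z)
  have hdiff (z : Fin n → Y) (i : Fin n) (v : Y) :
      |H (Function.update z i v) - H z| ≤ 2 * b / n := by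
    rw [hH, ← integral_sub (hint _) (hint _)]
    refine abs_integral_le_of_abs_le fun z' => ?_
    have hu := ENNReal.toReal_le_of_le_ofReal (by positivity)
      (ips_empiricalMeasure_update_le hF hFb z i v)
    have h1 := ENNReal.toReal_mono (ENNReal.add_ne_top.2 ⟨hfin _ _, hfin _ _⟩)
      (ips_triangle (F := F) (empiricalMeasure (Function.update z i v)) (empiricalMeasure z)
        (empiricalMeasure z'))
    have h2 := ENNReal.toReal_mono (ENNReal.add_ne_top.2 ⟨hfin _ _, hfin _ _⟩)
      (ips_triangle (F := F) (empiricalMeasure z) (empiricalMeasure (Function.update z i v))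
        (empiricalMeasure z'))
    rw [ENNReal.toReal_add (hfin _ _) (hfin _ _)] at h1 h2
    rw [ips_comm (empiricalMeasure z) (empiricalMeasure (Function.update z i v))] at h2
    rw [abs_le]
    constructor <;> linarith
  have hmean : ∫ z, H z ∂(Measure.pi fun _ : Fin n => μ) ≤ 2 * uniformRademacher F n := by
    rw [hH, ← integral_prod (fun q : (Fin n → Y) × (Fin n → Y) =>
        (ips F (empiricalMeasure q.1) (empiricalMeasure q.2)).toReal)
      (integrable_of_measurable_of_abs_le (hemp n).ennreal_toReal fun q => hle q.1 q.2),
      integral_toReal (hemp n).aemeasurable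
        (Eventually.of_forall fun q => (hfin q.1 q.2).lt_top)]
    refine ENNReal.toReal_le_of_le_ofReal
      (mul_nonneg zero_le_two (uniformRademacher_nonneg n)) ?_
    refine (lintegral_ips_empiricalMeasure_le hF hsign hemp μ n).trans ?_
    rw [ENNReal.ofReal_mul zero_le_two, ENNReal.ofReal_ofNat]
    gcongr
    exact rademacherComplexity_le_ofReal hb hFb μ n
  refine (measure_mono fun z hz => ?_).trans
    (measure_pi_bounded_difference_le μ (c := 2 * b / n) hHm hHB hdiff ht)
  have hz' := lt_of_lt_of_le hz (ips_empiricalMeasure_le_integral hF hb hFb hemp μ hn z)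
  have := (ENNReal.ofReal_lt_ofReal_iff' .. |>.1 hz').1
  change _ ≤ H z
  linarith

end Concentration

/-! ### Vanishing prior mass of thin shells -/

section Continuity

variable {Θ : Type*} [MeasurableSpace Θ] (π : Measure Θ) [IsFiniteMeasure π] {D : Θ → ℝ}

/-- The shells exclude the level a itself, so they decrease to the empty set even if D has an atom
there. -/
theorem tendsto_measure_right_shell (hD : Measurable D) (a : ℝ) :
    Tendsto (fun s => π {θ | a < D θ ∧ D θ ≤ a + s}) (𝓝[>] 0) (𝓝 0) := by
  have h := tendsto_measure_biInter_gt (μ := π) (s := fun s => {θ | a < D θ ∧ D θ ≤ a + s})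
    (a := (0 : ℝ))
    (fun s _ => ((measurableSet_lt measurable_const hD).inter
      (measurableSet_le hD measurable_const)).nullMeasurableSet)
    (fun i j _ hij θ hθ => ⟨hθ.1, hθ.2.trans (by linarith)⟩) ⟨1, one_pos, measure_ne_top _ _⟩
  have hempty : ⋂ s > (0 : ℝ), {θ | a < D θ ∧ D θ ≤ a + s} = ∅ := by
    refine Set.eq_empty_of_forall_notMem fun θ hθ => ?_
    simp only [Set.mem_iInter] at hθ
    have h1 : a < D θ := (hθ 1 one_pos).1
    have h2 := (hθ ((D θ - a) / 2) (by linarith)).2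
    linarith
  rwa [hempty, measure_empty] at h

theorem tendsto_measure_left_shell (hD : Measurable D) (a : ℝ) :
    Tendsto (fun s => π {θ | a - s < D θ ∧ D θ < a}) (𝓝[>] 0) (𝓝 0) := by
  have h := tendsto_measure_biInter_gt (μ := π) (s := fun s => {θ | a - s < D θ ∧ D θ < a})
    (a := (0 : ℝ))
    (fun s _ => ((measurableSet_lt measurable_const hD).inter
      (measurableSet_lt hD measurable_const)).nullMeasurableSet)
    (fun i j _ hij θ hθ => ⟨lt_of_le_of_lt (by linarith) hθ.1, hθ.2⟩)
    ⟨1, one_pos, measure_ne_top _ _⟩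
  have hempty : ⋂ s > (0 : ℝ), {θ | a - s < D θ ∧ D θ < a} = ∅ := by
    refine Set.eq_empty_of_forall_notMem fun θ hθ => ?_
    simp only [Set.mem_iInter] at hθ
    have h1 : D θ < a := (hθ 1 one_pos).2
    have h2 := (hθ ((a - D θ) / 2) (by linarith)).1
    linarith
  rwa [hempty, measure_empty] at h

end Continuity

/-! ### Acceptance probabilities at fixed n -/

section Acceptance

variable {Y Θ : Type*} [MeasurableSpace Y] [MeasurableSpace Θ] {F : Set (Y → ℝ)}
  {μstar : Measure Y} [IsProbabilityMeasure μstar] {model : Kernel Θ Y} [IsMarkovKernel model]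
  {b ε t : ℝ}

theorem ofReal_modelDiscrepancy (hFb : ∀ f ∈ F, ∀ x, |f x| ≤ b) (θ : Θ) :
    ENNReal.ofReal (modelDiscrepancy F model μstar θ) = ips F (model θ) μstar :=
  ENNReal.ofReal_toReal
    (ne_top_of_le_ne_top ENNReal.ofReal_ne_top (ips_le_of_abs_le hFb (model θ) μstar))

omit [IsProbabilityMeasure μstar] [IsMarkovKernel model] in
theorem modelDiscrepancy_nonneg (θ : Θ) : 0 ≤ modelDiscrepancy F model μstar θ :=
  ENNReal.toReal_nonneg

theorem modelDiscrepancy_le (hb : 0 ≤ b) (hFb : ∀ f ∈ F, ∀ x, |f x| ≤ b) (θ : Θ) :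
    modelDiscrepancy F model μstar θ ≤ 2 * b :=
  ENNReal.toReal_le_of_le_ofReal (by positivity) (ips_le_of_abs_le hFb (model θ) μstar)

variable {n : ℕ} {y : Fin n → Y} {τ : ℝ≥0∞}

/-- Acceptance and the deviation event together cover the sample space, by the triangle inequality
through μ_θ and μ*. The additive form needs only subadditivity, hence no measurability of either
event. -/
theorem one_le_acceptGiven_add (hFb : ∀ f ∈ F, ∀ x, |f x| ≤ b) (ht : 0 ≤ t)
    (hy : ips F (empiricalMeasure y) μstar ≤ ENNReal.ofReal (2 * uniformRademacher F n + t)) {θ : Θ}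
    (hτ : (Measure.pi fun _ : Fin n => model θ) {z | ENNReal.ofReal (2 * uniformRademacher F n + t) <
      ips F (empiricalMeasure z) (model θ)} ≤ τ)
    (hθ : modelDiscrepancy F model μstar θ ≤ ε - 4 * uniformRademacher F n - 2 * t) :
    1 ≤ acceptGiven F model ε y θ + τ := by
  have hr : 0 ≤ 2 * uniformRademacher F n + t :=
    add_nonneg (mul_nonneg zero_le_two (uniformRademacher_nonneg n)) ht
  rw [← measure_univ (μ := Measure.pi fun _ : Fin n => model θ)]
  refine le_trans (measure_mono fun z _ => ?_) ((measure_union_le _ _).trans (add_le_add le_rfl hτ))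
  rw [Set.mem_union, or_iff_not_imp_right]
  intro hz
  have hz' : ips F (empiricalMeasure z) (model θ) ≤
      ENNReal.ofReal (2 * uniformRademacher F n + t) :=
    not_lt.1 fun h => hz h
  calc ips F (empiricalMeasure z) (empiricalMeasure y)
      ≤ ips F (empiricalMeasure z) (model θ) +
          (ips F (model θ) μstar + ips F μstar (empiricalMeasure y)) :=
        (ips_triangle _ (model θ) _).trans (add_le_add le_rfl (ips_triangle _ μstar _))
    _ ≤ ENNReal.ofReal (2 * uniformRademacher F n + t) +
          (ENNReal.ofReal (modelDiscrepancy F model μstar θ) +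
            ENNReal.ofReal (2 * uniformRademacher F n + t)) := by
        rw [ofReal_modelDiscrepancy hFb, ips_comm μstar]
        gcongr
    _ ≤ ENNReal.ofReal ε := by
        rw [← ENNReal.ofReal_add (modelDiscrepancy_nonneg θ) hr,
          ← ENNReal.ofReal_add hr (add_nonneg (modelDiscrepancy_nonneg θ) hr)]
        exact ENNReal.ofReal_le_ofReal (by linarith)

theorem acceptGiven_le (hFb : ∀ f ∈ F, ∀ x, |f x| ≤ b) (hε : 0 ≤ ε) (ht : 0 ≤ t)
    (hy : ips F (empiricalMeasure y) μstar ≤ ENNReal.ofReal (2 * uniformRademacher F n + t)) {θ : Θ}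
    (hτ : (Measure.pi fun _ : Fin n => model θ) {z | ENNReal.ofReal (2 * uniformRademacher F n + t) <
      ips F (empiricalMeasure z) (model θ)} ≤ τ)
    (hθ : ε + 4 * uniformRademacher F n + 2 * t < modelDiscrepancy F model μstar θ) :
    acceptGiven F model ε y θ ≤ τ := by
  have hr : 0 ≤ 2 * uniformRademacher F n + t :=
    add_nonneg (mul_nonneg zero_le_two (uniformRademacher_nonneg n)) ht
  refine (measure_mono fun z hz => ?_).trans hτ
  by_contra hz2
  have hz' : ips F (empiricalMeasure z) (model θ) ≤
      ENNReal.ofReal (2 * uniformRademacher F n + t) :=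
    not_lt.1 fun h => hz2 h
  have h : ENNReal.ofReal (modelDiscrepancy F model μstar θ) ≤
      ENNReal.ofReal (2 * uniformRademacher F n + t + (ε + (2 * uniformRademacher F n + t))) := by
    rw [ENNReal.ofReal_add hr (add_nonneg hε hr), ENNReal.ofReal_add hε hr,
      ofReal_modelDiscrepancy hFb]
    calc ips F (model θ) μstar
        ≤ ips F (model θ) (empiricalMeasure z) +
          (ips F (empiricalMeasure z) (empiricalMeasure y) + ips F (empiricalMeasure y) μstar) :=
        (ips_triangle _ (empiricalMeasure z) _).trans
          (add_le_add le_rfl (ips_triangle _ (empiricalMeasure y) _))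
      _ ≤ _ := by
        rw [ips_comm (model θ)]
        exact add_le_add hz' (add_le_add hz hy)
  have := (ENNReal.ofReal_le_ofReal_iff (add_nonneg hr (add_nonneg hε hr))).1 h
  linarith

variable {prior : Measure Θ} [IsProbabilityMeasure prior]

theorem acceptGiven_le_one (θ : Θ) : acceptGiven F model ε y θ ≤ 1 := prob_le_one

theorem acceptProb_le_one : acceptProb F model prior ε y ≤ 1 := by
  refine (lintegral_mono fun θ => acceptGiven_le_one θ).trans ?_
  simp

theorem measure_le_acceptProb_add (hFb : ∀ f ∈ F, ∀ x, |f x| ≤ b) (ht : 0 ≤ t)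
    (hD : Measurable (modelDiscrepancy F model μstar))
    (hy : ips F (empiricalMeasure y) μstar ≤ ENNReal.ofReal (2 * uniformRademacher F n + t))
    (hτ : ∀ θ, (Measure.pi fun _ : Fin n => model θ)
      {z | ENNReal.ofReal (2 * uniformRademacher F n + t) <
        ips F (empiricalMeasure z) (model θ)} ≤ τ) :
    prior {θ | modelDiscrepancy F model μstar θ ≤ ε - 4 * uniformRademacher F n - 2 * t} ≤
      acceptProb F model prior ε y + τ := by
  set A := {θ | modelDiscrepancy F model μstar θ ≤ ε - 4 * uniformRademacher F n - 2 * t} with hA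
  have hAm : MeasurableSet A := measurableSet_le hD measurable_const
  calc prior A = ∫⁻ _ in A, 1 ∂prior := by simp
    _ ≤ ∫⁻ θ in A, (acceptGiven F model ε y θ + τ) ∂prior :=
        setLIntegral_mono' hAm fun θ hθ => one_le_acceptGiven_add hFb ht hy (hτ θ) hθ
    _ ≤ ∫⁻ θ, (acceptGiven F model ε y θ + τ) ∂prior := setLIntegral_le_lintegral _ _
    _ = acceptProb F model prior ε y + τ := by
        rw [lintegral_add_right _ measurable_const, acceptProb]; simp

/-- Acceptance is at most 1 on the shell and at most τ beyond it. The constant τ is the measurable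
summand when the integral is split, so measurability of `acceptGiven` in θ plays no role. -/
theorem setLIntegral_acceptGiven_le (hFb : ∀ f ∈ F, ∀ x, |f x| ≤ b) (hε : 0 ≤ ε) (ht : 0 ≤ t)
    (hD : Measurable (modelDiscrepancy F model μstar))
    (hy : ips F (empiricalMeasure y) μstar ≤ ENNReal.ofReal (2 * uniformRademacher F n + t))
    (hτ : ∀ θ, (Measure.pi fun _ : Fin n => model θ)
      {z | ENNReal.ofReal (2 * uniformRademacher F n + t) <
        ips F (empiricalMeasure z) (model θ)} ≤ τ) (a : ℝ) :
    ∫⁻ θ in {θ | a < modelDiscrepancy F model μstar θ}, acceptGiven F model ε y θ ∂prior ≤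
      prior {θ | a < modelDiscrepancy F model μstar θ ∧
        modelDiscrepancy F model μstar θ ≤ ε + 4 * uniformRademacher F n + 2 * t} + τ := by
  set B := {θ | a < modelDiscrepancy F model μstar θ}
  set C := {θ | modelDiscrepancy F model μstar θ ≤ ε + 4 * uniformRademacher F n + 2 * t} with hC
  have hCm : MeasurableSet C := measurableSet_le hD measurable_const
  have hpt (θ : Θ) : acceptGiven F model ε y θ ≤ C.indicator 1 θ + τ := by
    by_cases hθ : θ ∈ C
    · simpa [hθ] using le_add_right (acceptGiven_le_one θ)
    · simpa [hθ] using acceptGiven_le hFb hε ht hy (hτ θ) (not_le.1 hθ)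
  calc ∫⁻ θ in B, acceptGiven F model ε y θ ∂prior
      ≤ ∫⁻ θ in B, (C.indicator 1 θ + τ) ∂prior := lintegral_mono hpt
    _ = prior (B ∩ C) + τ * prior B := by
        rw [lintegral_add_right _ measurable_const, lintegral_indicator_one hCm,
          Measure.restrict_apply hCm, Set.inter_comm, setLIntegral_const]
    _ ≤ prior (B ∩ C) + τ := by
        gcongr
        exact mul_le_of_le_one_right' prob_le_one

end Acceptance

/-! ### Summability of the tail bound -/

section Tail

/-- The tail bound at `t` for the distance between an empirical distribution of size `n` and the
sampling distribution. -/
noncomputable def empiricalTail (b t : ℝ) (n : ℕ) : ℝ≥0∞ :=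
  ENNReal.ofReal (Real.exp (-t ^ 2 / (2 * (n * (2 * b / n) ^ 2))))

theorem tsum_empiricalTail_ne_top {b t : ℝ} (hb : 0 < b) (ht : 0 < t) :
    ∑' n, empiricalTail b t n ≠ ∞ := by
  -- The tail is geometric in n. At n = 0 division by zero makes both sides equal to 1.
  have h (n : ℕ) : Real.exp (-t ^ 2 / (2 * (n * (2 * b / n) ^ 2))) =
      Real.exp (-(t ^ 2 / (8 * b ^ 2))) ^ n := by
    rw [← Real.exp_nat_mul]
    rcases Nat.eq_zero_or_pos n with rfl | hn
    · simp
    · have : (n : ℝ) ≠ 0 := by positivity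
      congr 1
      field_simp
      ring
  simp_rw [empiricalTail, h]
  refine (summable_geometric_of_lt_one (Real.exp_nonneg _) ?_).tsum_ofReal_ne_top
  rw [Real.exp_lt_one_iff]
  have : 0 < t ^ 2 / (8 * b ^ 2) := by positivity
  linarith

theorem tendsto_empiricalTail {b t : ℝ} (hb : 0 < b) (ht : 0 < t) :
    Tendsto (empiricalTail b t) atTop (𝓝 0) :=
  ENNReal.tendsto_atTop_zero_of_tsum_ne_top (tsum_empiricalTail_ne_top hb ht)

end Tail

/-! ### Almost sure control of the observed sample -/

section Sample

variable {Y Ω : Type*} [MeasurableSpace Y] [MeasurableSpace Ω] {μstar : Measure Y}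
  [IsProbabilityMeasure μstar] {P : Measure Ω} [IsProbabilityMeasure P] {y : ℕ → Ω → Y}

omit [IsProbabilityMeasure μstar] in
theorem map_sample_eq_pi (hy_meas : ∀ i, Measurable (y i)) (hy_indep : iIndepFun y P)
    (hy_law : ∀ i, P.map (y i) = μstar) (n : ℕ) :
    P.map (fun ω (i : Fin n) => y i ω) = Measure.pi fun _ => μstar := by
  have h := (iIndepFun_iff_map_fun_eq_pi_map (f := fun i : Fin n => y i)
    fun i => (hy_meas i).aemeasurable).1 (hy_indep.precomp Fin.val_injective)
  rw [h]
  simp_rw [hy_law]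

omit [IsProbabilityMeasure μstar] in
theorem ae_eventually_ips_empiricalMeasure_le (hy_meas : ∀ i, Measurable (y i))
    (hy_indep : iIndepFun y P) (hy_law : ∀ i, P.map (y i) = μstar)
    {F : Set (Y → ℝ)} {b : ℝ} (hb : 0 < b)
    (htail : ∀ n ≠ 0, ∀ t : ℝ, 0 ≤ t → (Measure.pi fun _ : Fin n => μstar)
      {z | ENNReal.ofReal (2 * uniformRademacher F n + t) < ips F (empiricalMeasure z) μstar} ≤
        empiricalTail b t n) :
    ∀ᵐ ω ∂P, ∀ t : ℝ, 0 < t → ∀ᶠ n : ℕ in atTop,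
      ips F (empiricalMeasure fun i : Fin n => y i ω) μstar ≤
        ENNReal.ofReal (2 * uniformRademacher F n + t) := by
  have hfix (t : ℝ) (ht : 0 < t) : ∀ᵐ ω ∂P, ∀ᶠ n : ℕ in atTop,
      ips F (empiricalMeasure fun i : Fin n => y i ω) μstar ≤
        ENNReal.ofReal (2 * uniformRademacher F n + t) := by
    set bad : ℕ → Set Ω := fun n => {ω | ENNReal.ofReal (2 * uniformRademacher F (n + 1) + t) <
      ips F (empiricalMeasure fun i : Fin (n + 1) => y i ω) μstar} with hbad
    have hle (n : ℕ) : P (bad n) ≤ empiricalTail b t (n + 1) := by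
      refine le_trans ?_ (htail (n + 1) n.succ_ne_zero t ht.le)
      rw [← map_sample_eq_pi hy_meas hy_indep hy_law]
      exact Measure.le_map_apply (f := fun ω (i : Fin (n + 1)) => y i ω)
        (measurable_pi_lambda _ fun i : Fin (n + 1) => hy_meas i).aemeasurable
        {z | ENNReal.ofReal (2 * uniformRademacher F (n + 1) + t) < ips F (empiricalMeasure z) μstar}
    have hsum : ∑' n, P (bad n) ≠ ∞ :=
      ne_top_of_le_ne_top (tsum_empiricalTail_ne_top hb ht)
        ((ENNReal.tsum_le_tsum hle).trans
          (ENNReal.tsum_comp_le_tsum_of_injective (add_left_injective 1) (empiricalTail b t)))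
    filter_upwards [ae_eventually_notMem hsum] with ω hω
    rw [← map_add_atTop_eq_nat 1, eventually_map]
    filter_upwards [hω] with n hn
    exact not_lt.1 fun h => hn h
  -- The exceptional null set depends on t; countably many t = 1/(k+1) suffice because the bound is
  -- monotone in t.
  have hall : ∀ᵐ ω ∂P, ∀ k : ℕ, ∀ᶠ n : ℕ in atTop,
      ips F (empiricalMeasure fun i : Fin n => y i ω) μstar ≤
        ENNReal.ofReal (2 * uniformRademacher F n + 1 / (k + 1 : ℝ)) :=
    ae_all_iff.2 fun k => hfix _ (by positivity)
  filter_upwards [hall] with ω hω t ht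
  obtain ⟨k, hk⟩ := exists_nat_one_div_lt ht
  filter_upwards [hω k] with n hn
  exact hn.trans (ENNReal.ofReal_le_ofReal (by linarith))

end Sample

/-! ### Limits along a fixed good data sequence -/

section Limits

variable {Y Θ : Type*} [MeasurableSpace Y] [MeasurableSpace Θ] {F : Set (Y → ℝ)}
  {μstar : Measure Y} [IsProbabilityMeasure μstar] {model : Kernel Θ Y} [IsMarkovKernel model]
  {prior : Measure Θ} [IsProbabilityMeasure prior] {b ε : ℝ} {y : ℕ → Y}

theorem tendsto_setLIntegral_acceptGiven (hb : 0 < b) (hFb : ∀ f ∈ F, ∀ x, |f x| ≤ b)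
    (hlim : Tendsto (fun n => 4 * uniformRademacher F n) atTop (𝓝 (cConst F)))
    (hε : 0 ≤ ε) (hD : Measurable (modelDiscrepancy F model μstar))
    (hy : ∀ t : ℝ, 0 < t → ∀ᶠ n : ℕ in atTop,
      ips F (empiricalMeasure fun i : Fin n => y i) μstar ≤
        ENNReal.ofReal (2 * uniformRademacher F n + t))
    (htail : ∀ n ≠ 0, ∀ t : ℝ, 0 ≤ t → ∀ θ, (Measure.pi fun _ : Fin n => model θ)
      {z | ENNReal.ofReal (2 * uniformRademacher F n + t) <
        ips F (empiricalMeasure z) (model θ)} ≤ empiricalTail b t n) :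
    Tendsto (fun n : ℕ => ∫⁻ θ in {θ | ε + cConst F < modelDiscrepancy F model μstar θ},
      acceptGiven F model ε (fun i : Fin n => y i) θ ∂prior) atTop (𝓝 0) := by
  rw [ENNReal.tendsto_nhds_zero]
  intro η hη
  have hη2 : 0 < η / 2 := ENNReal.half_pos hη.ne'
  obtain ⟨s, hs, hs0⟩ := (((ENNReal.tendsto_nhds_zero.1
    (tendsto_measure_right_shell prior hD (ε + cConst F))) (η / 2) hη2).and
      self_mem_nhdsWithin).exists
  have hs0' : 0 < s := hs0
  -- With t = s/4, the term 2t uses half of the shell width s; the other half absorbs 4R_n - c_F.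
  have ht : 0 < s / 4 := by linarith
  filter_upwards [hy _ ht, eventually_ne_atTop 0,
    ENNReal.tendsto_nhds_zero.1 (tendsto_empiricalTail hb ht) _ hη2,
    hlim.eventually_lt_const (show cConst F < cConst F + s / 2 by linarith)] with n hn hn0 hτ hR
  refine (setLIntegral_acceptGiven_le hFb hε ht.le hD hn (htail n hn0 _ ht.le) _).trans ?_
  rw [← ENNReal.add_halves η]
  have hsub : {θ | ε + cConst F < modelDiscrepancy F model μstar θ ∧
      modelDiscrepancy F model μstar θ ≤ ε + 4 * uniformRademacher F n + 2 * (s / 4)} ⊆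
      {θ | ε + cConst F < modelDiscrepancy F model μstar θ ∧
        modelDiscrepancy F model μstar θ ≤ ε + cConst F + s} :=
    fun θ hθ => ⟨hθ.1, hθ.2.trans (by linarith)⟩
  exact add_le_add ((measure_mono hsub).trans hs) hτ

theorem eventually_measure_lt_le_acceptProb_add (hb : 0 < b) (hFb : ∀ f ∈ F, ∀ x, |f x| ≤ b)
    (hlim : Tendsto (fun n => 4 * uniformRademacher F n) atTop (𝓝 (cConst F)))
    (hD : Measurable (modelDiscrepancy F model μstar))
    (hy : ∀ t : ℝ, 0 < t → ∀ᶠ n : ℕ in atTop,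
      ips F (empiricalMeasure fun i : Fin n => y i) μstar ≤
        ENNReal.ofReal (2 * uniformRademacher F n + t))
    (htail : ∀ n ≠ 0, ∀ t : ℝ, 0 ≤ t → ∀ θ, (Measure.pi fun _ : Fin n => model θ)
      {z | ENNReal.ofReal (2 * uniformRademacher F n + t) <
        ips F (empiricalMeasure z) (model θ)} ≤ empiricalTail b t n) {η : ℝ} (hη : 0 < η) :
    ∀ᶠ n : ℕ in atTop, prior.real {θ | modelDiscrepancy F model μstar θ < ε - cConst F} - η ≤
      (acceptProb F model prior ε fun i : Fin n => y i).toReal := by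
  have hη2 : 0 < ENNReal.ofReal (η / 2) := ENNReal.ofReal_pos.2 (half_pos hη)
  obtain ⟨s, hs, hs0⟩ := (((ENNReal.tendsto_nhds_zero.1
    (tendsto_measure_left_shell prior hD (ε - cConst F))) _ hη2).and
      self_mem_nhdsWithin).exists
  have hs0' : 0 < s := hs0
  have ht : 0 < s / 4 := by linarith
  filter_upwards [hy _ ht, eventually_ne_atTop 0,
    ENNReal.tendsto_nhds_zero.1 (tendsto_empiricalTail hb ht) _ hη2,
    hlim.eventually_lt_const (show cConst F < cConst F + s / 2 by linarith)] with n hn hn0 hτ hR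
  have h1 := measure_le_acceptProb_add (prior := prior) (ε := ε) hFb ht.le hD hn
    (htail n hn0 _ ht.le)
  have hfin : acceptProb F model prior ε (fun i : Fin n => y i) ≠ ∞ :=
    ne_top_of_le_ne_top ENNReal.one_ne_top acceptProb_le_one
  have h2 : prior {θ | modelDiscrepancy F model μstar θ < ε - cConst F} ≤
      acceptProb F model prior ε (fun i : Fin n => y i) + ENNReal.ofReal η := by
    calc prior {θ | modelDiscrepancy F model μstar θ < ε - cConst F}
        ≤ prior ({θ | modelDiscrepancy F model μstar θ ≤
              ε - 4 * uniformRademacher F n - 2 * (s / 4)} ∪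
            {θ | ε - cConst F - s < modelDiscrepancy F model μstar θ ∧
              modelDiscrepancy F model μstar θ < ε - cConst F}) := by
          refine measure_mono fun θ hθ => ?_
          rcases lt_or_ge (ε - cConst F - s) (modelDiscrepancy F model μstar θ) with h | h
          · exact Or.inr ⟨h, hθ⟩
          · exact Or.inl (h.trans (by linarith))
      _ ≤ _ := (measure_union_le _ _).trans (add_le_add (h1.trans (add_le_add le_rfl hτ)) hs)
      _ = _ := by
          rw [add_assoc, ← ENNReal.ofReal_add (half_pos hη).le (half_pos hη).le, add_halves]
  have h3 := ENNReal.toReal_mono (ENNReal.add_ne_top.2 ⟨hfin, ENNReal.ofReal_ne_top⟩) h2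
  rw [ENNReal.toReal_add hfin ENNReal.ofReal_ne_top, ENNReal.toReal_ofReal hη.le] at h3
  rw [measureReal_def]
  linarith

omit [IsProbabilityMeasure μstar] [IsProbabilityMeasure prior] in
theorem acceptProb_le_measure_add (hD : Measurable (modelDiscrepancy F model μstar)) (a : ℝ)
    {n : ℕ} (z : Fin n → Y) :
    acceptProb F model prior ε z ≤ prior {θ | modelDiscrepancy F model μstar θ ≤ a} +
      ∫⁻ θ in {θ | a < modelDiscrepancy F model μstar θ}, acceptGiven F model ε z θ ∂prior := by
  have hA : MeasurableSet {θ | modelDiscrepancy F model μstar θ ≤ a} :=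
    measurableSet_le hD measurable_const
  have hc : {θ | modelDiscrepancy F model μstar θ ≤ a}ᶜ =
      {θ | a < modelDiscrepancy F model μstar θ} := by
    ext θ; simp
  rw [acceptProb, ← lintegral_add_compl _ hA, hc]
  gcongr
  refine (lintegral_mono fun θ => acceptGiven_le_one θ).trans ?_
  simp

theorem isProbabilityMeasure_abcPosterior {n : ℕ} {z : Fin n → Y}
    (h : acceptProb F model prior ε z ≠ 0) :
    IsProbabilityMeasure (abcPosterior F model prior ε z) := by
  refine ⟨?_⟩
  rw [abcPosterior, Measure.smul_apply, withDensity_apply _ MeasurableSet.univ, smul_eq_mul,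
    Measure.restrict_univ]
  exact ENNReal.inv_mul_cancel h (ne_top_of_le_ne_top ENNReal.one_ne_top acceptProb_le_one)

end Limits

/-! ### Assembly of the asymptotic statements -/

theorem exists_tendsto_zero_add_le {u : ℕ → ℝ} {L : ℝ}
    (h : ∀ η : ℝ, 0 < η → ∀ᶠ n in atTop, L - η ≤ u n) :
    ∃ r : ℕ → ℝ, Tendsto r atTop (𝓝 0) ∧ ∀ n, L + r n ≤ u n := by
  refine ⟨fun n => min 0 (u n - L), ?_, fun n => ?_⟩
  · rw [Metric.tendsto_atTop']
    intro η hη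
    obtain ⟨N, hN⟩ := eventually_atTop.1 (h (η / 2) (half_pos hη))
    refine ⟨N, fun n hn => ?_⟩
    have h1 : -(η / 2) ≤ min 0 (u n - L) := le_min (by linarith) (by linarith [hN n hn.le])
    have h2 : min 0 (u n - L) ≤ 0 := min_le_left _ _
    rw [Real.dist_eq, sub_zero, abs_lt]
    constructor <;> linarith
  · have := min_le_right 0 (u n - L)
    linarith

theorem theorem1 {Y Θ Ω : Type*} [MeasurableSpace Y] [MeasurableSpace Θ] [MeasurableSpace Ω]
    -- data generating process, statistical model, prior
    (μstar : Measure Y) [IsProbabilityMeasure μstar]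
    (model : Kernel Θ Y) [IsMarkovKernel model]
    (prior : Measure Θ) [IsProbabilityMeasure prior]
    -- observed data, i.i.d. from the data generating process
    (P : Measure Ω) [IsProbabilityMeasure P] (y : ℕ → Ω → Y)
    (hy_meas : ∀ i, Measurable (y i)) (hy_indep : iIndepFun y P)
    (hy_law : ∀ i, P.map (y i) = μstar)
    -- uniformly bounded class of measurable functions
    (F : Set (Y → ℝ)) (hF_meas : ∀ f ∈ F, Measurable f)
    (b : ℝ) (hF_bdd : ∀ f ∈ F, ∀ x, |f x| ≤ b)
    -- measurability of the suprema over the class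
    (hF_sign : ∀ (n : ℕ) (s : Fin n → ℤˣ), Measurable (signedSup F s))
    (hF_emp : ∀ n : ℕ, Measurable fun q : (Fin n → Y) × (Fin n → Y) =>
      ips F (empiricalMeasure q.1) (empiricalMeasure q.2))
    (hF_model : Measurable (modelDiscrepancy F model μstar))
    (ε : ℝ) (hε : 0 < ε) :
    -- lower bound on the acceptance probability
    (∀ᵐ ω ∂P, ∃ r : ℕ → ℝ, Tendsto r atTop (𝓝 0) ∧ ∀ n : ℕ,
      prior.real {θ | modelDiscrepancy F model μstar θ < ε - cConst F} + r n ≤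
        (acceptProb F model prior ε fun i : Fin n => y i ω).toReal) ∧
    (prior {θ | modelDiscrepancy F model μstar θ = ε - cConst F} = 0 →
      ∀ᵐ ω ∂P, ∃ r : ℕ → ℝ, Tendsto r atTop (𝓝 0) ∧ ∀ n : ℕ,
        prior.real {θ | modelDiscrepancy F model μstar θ ≤ ε - cConst F} + r n ≤
          (acceptProb F model prior ε fun i : Fin n => y i ω).toReal) ∧
    -- upper bound on the acceptance probability
    (∀ᵐ ω ∂P, ∃ r : ℕ → ℝ, Tendsto r atTop (𝓝 0) ∧ ∀ n : ℕ,
      (acceptProb F model prior ε fun i : Fin n => y i ω).toReal ≤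
        prior.real {θ | modelDiscrepancy F model μstar θ ≤ ε + cConst F} + r n) ∧
    -- above the critical threshold
    (epsTilde F model μstar prior + cConst F < ε →
      (∃ δ : ℝ, 0 < δ ∧ ∀ᵐ ω ∂P, ∀ᶠ n : ℕ in atTop,
        δ ≤ (acceptProb F model prior ε fun i : Fin n => y i ω).toReal) ∧
      (∀ᵐ ω ∂P, ∀ᶠ n : ℕ in atTop,
        IsProbabilityMeasure (abcPosterior F model prior ε fun i : Fin n => y i ω)) ∧
      (∀ᵐ ω ∂P, Tendsto
        (fun n : ℕ => (abcPosterior F model prior ε fun i : Fin n => y i ω)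
          {θ | modelDiscrepancy F model μstar θ ≤ ε + 4 * uniformRademacher F n})
        atTop (𝓝 1))) := by
  -- The bound is enlarged to be strictly positive: for b = 0 the tail formula degenerates to 1 and
  -- is not summable.
  set b' : ℝ := |b| + 1 with hb'_def
  have hb : 0 < b' := by positivity
  have hFb : ∀ f ∈ F, ∀ x, |f x| ≤ b' := fun f hf x => by
    linarith [hF_bdd f hf x, le_abs_self b]
  have htail (μ : Measure Y) [IsProbabilityMeasure μ] (n : ℕ) (hn : n ≠ 0) (t : ℝ) (ht : 0 ≤ t) :
      (Measure.pi fun _ : Fin n => μ)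
        {z | ENNReal.ofReal (2 * uniformRademacher F n + t) < ips F (empiricalMeasure z) μ} ≤
        empiricalTail b' t n :=
    measure_pi_lt_ips_empiricalMeasure_le hF_meas hb.le hFb hF_sign hF_emp μ hn ht
  have htailθ (n : ℕ) (hn : n ≠ 0) (t : ℝ) (ht : 0 ≤ t) (θ : Θ) := htail (model θ) n hn t ht
  have hlim := tendsto_uniformRademacher hb.le hFb hF_sign
  have hgood := ae_eventually_ips_empiricalMeasure_le hy_meas hy_indep hy_law hb (htail μstar)
  have hfin {n : ℕ} (z : Fin n → Y) : acceptProb F model prior ε z ≠ ∞ :=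
    ne_top_of_le_ne_top ENNReal.one_ne_top acceptProb_le_one
  have hlower : ∀ᵐ ω ∂P, ∀ η : ℝ, 0 < η → ∀ᶠ n : ℕ in atTop,
      prior.real {θ | modelDiscrepancy F model μstar θ < ε - cConst F} - η ≤
        (acceptProb F model prior ε fun i : Fin n => y i ω).toReal := by
    filter_upwards [hgood] with ω hω η hη
    exact eventually_measure_lt_le_acceptProb_add (y := fun i => y i ω) hb hFb hlim hF_model hω
      htailθ hη
  have htend : ∀ᵐ ω ∂P, Tendsto
      (fun n : ℕ => ∫⁻ θ in {θ | ε + cConst F < modelDiscrepancy F model μstar θ},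
        acceptGiven F model ε (fun i : Fin n => y i ω) θ ∂prior) atTop (𝓝 0) := by
    filter_upwards [hgood] with ω hω
    exact tendsto_setLIntegral_acceptGiven (y := fun i => y i ω) hb hFb hlim hε.le hF_model hω htailθ
  refine ⟨?_, fun hnull => ?_, ?_, fun hcrit => ?_⟩
  · filter_upwards [hlower] with ω hω
    exact exists_tendsto_zero_add_le hω
  · have heq : prior.real {θ | modelDiscrepancy F model μstar θ ≤ ε - cConst F} ≤
        prior.real {θ | modelDiscrepancy F model μstar θ < ε - cConst F} := by
      have hsub : {θ | modelDiscrepancy F model μstar θ ≤ ε - cConst F} ⊆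
          {θ | modelDiscrepancy F model μstar θ < ε - cConst F} ∪
            {θ | modelDiscrepancy F model μstar θ = ε - cConst F} :=
        fun θ hθ => by
          have h : modelDiscrepancy F model μstar θ ≤ ε - cConst F := hθ
          exact h.lt_or_eq.elim Or.inl Or.inr
      refine ENNReal.toReal_mono (measure_ne_top _ _) ?_
      simpa [hnull] using (measure_mono hsub).trans (measure_union_le (μ := prior) _ _)
    filter_upwards [hlower] with ω hω
    refine exists_tendsto_zero_add_le fun η hη => ?_
    filter_upwards [hω η hη] with n hn
    linarith
  · filter_upwards [htend] with ω hω
    refine ⟨fun n : ℕ => (∫⁻ θ in {θ | ε + cConst F < modelDiscrepancy F model μstar θ},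
      acceptGiven F model ε (fun i : Fin n => y i ω) θ ∂prior).toReal, ?_, fun n => ?_⟩
    · rw [← ENNReal.toReal_zero]
      exact (ENNReal.tendsto_toReal ENNReal.zero_ne_top).comp hω
    · have hne : ∫⁻ θ in {θ | ε + cConst F < modelDiscrepancy F model μstar θ},
          acceptGiven F model ε (fun i : Fin n => y i ω) θ ∂prior ≠ ∞ :=
        ne_top_of_le_ne_top (hfin fun i : Fin n => y i ω) (setLIntegral_le_lintegral _ _)
      rw [measureReal_def, ← ENNReal.toReal_add (measure_ne_top _ _) hne]
      exact ENNReal.toReal_mono (ENNReal.add_ne_top.2 ⟨measure_ne_top _ _, hne⟩)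
        (acceptProb_le_measure_add hF_model _ _)
  · have hne : {t : ℝ | 0 < t ∧ 0 < prior {θ | modelDiscrepancy F model μstar θ ≤ t}}.Nonempty := by
      refine ⟨2 * b', by positivity, ?_⟩
      have huniv : {θ | modelDiscrepancy F model μstar θ ≤ 2 * b'} = Set.univ :=
        Set.eq_univ_of_forall fun θ => modelDiscrepancy_le hb.le hFb θ
      rw [huniv, measure_univ]
      exact one_pos
    obtain ⟨t, ⟨-, htpos⟩, htlt⟩ := exists_lt_of_csInf_lt hne (lt_sub_iff_add_lt.2 hcrit)
    have hL : 0 < prior.real {θ | modelDiscrepancy F model μstar θ < ε - cConst F} := by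
      have hsub : {θ | modelDiscrepancy F model μstar θ ≤ t} ⊆
          {θ | modelDiscrepancy F model μstar θ < ε - cConst F} :=
        fun θ hθ => lt_of_le_of_lt hθ htlt
      exact ENNReal.toReal_pos (htpos.trans_le (measure_mono hsub)).ne' (measure_ne_top _ _)
    set δ := prior.real {θ | modelDiscrepancy F model μstar θ < ε - cConst F} / 2 with hδ
    have hδ0 : 0 < δ := half_pos hL
    have hacc : ∀ᵐ ω ∂P, ∀ᶠ n : ℕ in atTop,
        δ ≤ (acceptProb F model prior ε fun i : Fin n => y i ω).toReal := by
      filter_upwards [hlower] with ω hω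
      filter_upwards [hω δ hδ0] with n hn
      linarith
    have hprob {n : ℕ} {z : Fin n → Y} (h : δ ≤ (acceptProb F model prior ε z).toReal) :
        IsProbabilityMeasure (abcPosterior F model prior ε z) :=
      isProbabilityMeasure_abcPosterior fun h0 => by
        rw [h0, ENNReal.toReal_zero] at h
        linarith
    refine ⟨⟨δ, hδ0, hacc⟩, ?_, ?_⟩
    · filter_upwards [hacc] with ω hω
      filter_upwards [hω] with n hn
      exact hprob hn
    · filter_upwards [hacc, htend] with ω hω hω'
      have hδ1 : (ENNReal.ofReal δ)⁻¹ ≠ ∞ :=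
        ENNReal.inv_ne_top.2 (ENNReal.ofReal_pos.2 hδ0).ne'
      -- Lower side of the squeeze: the normalizing factor is at most 1/δ, and the accepted mass of
      -- {D > ε + c_F} vanishes.
      have hsq : Tendsto (fun n : ℕ => 1 - (ENNReal.ofReal δ)⁻¹ *
          ∫⁻ θ in {θ | ε + cConst F < modelDiscrepancy F model μstar θ},
            acceptGiven F model ε (fun i : Fin n => y i ω) θ ∂prior) atTop (𝓝 1) := by
        have h := ENNReal.Tendsto.const_mul hω' (Or.inr hδ1)
        rw [mul_zero] at h
        simpa using ENNReal.Tendsto.sub tendsto_const_nhds h (Or.inl ENNReal.one_ne_top)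
      refine tendsto_of_tendsto_of_tendsto_of_le_of_le' hsq tendsto_const_nhds ?_ ?_
      · filter_upwards [hω, eventually_ne_atTop 0] with n hn hn0
        have := hprob hn
        set A := {θ | modelDiscrepancy F model μstar θ ≤ ε + 4 * uniformRademacher F n} with hA
        have hAm : MeasurableSet A := measurableSet_le hF_model measurable_const
        -- Since c_F ≤ 4R_n, the moving complement lies in one fixed set.
        have hAc : Aᶜ ⊆ {θ | ε + cConst F < modelDiscrepancy F model μstar θ} := by
          intro θ hθ
          have h1 : ε + 4 * uniformRademacher F n < modelDiscrepancy F model μstar θ :=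
            not_le.1 fun h => hθ h
          have h2 := cConst_le hb.le hFb hF_sign hn0
          exact lt_of_le_of_lt (by linarith) h1
        rw [← compl_compl A, prob_compl_eq_one_sub hAm.compl]
        refine tsub_le_tsub_left ?_ _
        rw [abcPosterior, Measure.smul_apply, withDensity_apply _ hAm.compl, smul_eq_mul]
        gcongr
        exact (ENNReal.ofReal_le_iff_le_toReal (hfin _)).2 hn
      · filter_upwards [hω] with n hn
        have := hprob hn
        exact prob_le_one
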